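/- Let $(x)_k=x(x+1)\cdots(x+k-1)$ be the rising factorial. Let $n\ge -1$ be an integer and let $a,b\in\mathbb{C}$ be such that $a-b\notin\{0,-1,-2,\dots\}$ and, if $n\ge 0$, $(a)_n\neq 0$. Let ${}_2F_1(a+n,b;a-b;z)$ denote the analytic continuation to $\mathbb{C}\setminus[1,\infty)$ of the Gauss hypergeometric series $\sum_{k\ge 0}\frac{(a+n)_k(b)_k}{(a-b)_k\,k!}z^k$, $|z|<1$. Then $${}_2F_1(a+n,b;a-b;-1)=P(n)\,\frac{\Gamma(a-b)\,\Gamma(\frac{a+1}{2})}{\Gamma(a)\,\Gamma(\frac{a+1}{2}-b)}+Q(n)\,\frac{\Gamma(a-b)\,\Gamma(\frac{a}{2})}{\Gamma(a)\,\Gamma(\frac{a}{2}-b)},$$ where $$P(n)=\frac{1}{2^{n+1}}\;{}_3F_2\!\left(-\tfrac{n}{2},-\tfrac{n+1}{2},\tfrac{a}{2}-b;\ \tfrac12,\tfrac{a}{2};\ 1\right),\qquad Q(n)=\frac{n+1}{2^{n+1}}\;{}_3F_2\!\left(-\tfrac{n-1}{2},-\tfrac{n}{2},\tfrac{a+1}{2}-b;\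 \tfrac32,\tfrac{a+1}{2};\ 1\right).$$ Here ${}_3F_2(A,B,C;D,E;1)=\sum_{k\ge0}\frac{(A)_k(B)_k(C)_k}{(D)_k(E)_k\,k!}$. Both series are well-defined terminating sums, that is, some upper parameter equals $-m$ with $m\ge0$ an integer, the sum runs over $0\le k\le m$, and no denominator vanishes in this range; the only exception is the series in $Q(n)$ for $n=-1$, where the prefactor is zero and $Q(-1)=0$. In the $\Gamma$-terms, $1/\Gamma$ is $0$ at the poles of $\Gamma$, and where $\Gamma(a)$ and the $\Gamma$-factor $\Gamma(\frac{a+1}{2})$ or $\Gamma(\frac a2)$ above it both have a pole, the $\Gamma$-term denotes its limit as the first parameter tends to $a$ (a removable singularity). -/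

import Mathlib

open Complex Filter Topology

/-- The plane cut along the ray `[1, ∞)` of the real axis. -/
def cutPlane : Set ℂ := {z : ℂ | ¬ (z.im = 0 ∧ 1 ≤ z.re)}

/-- `F` is the analytic continuation to the cut plane of the Gauss hypergeometric series
with upper parameters `A`, `B` and lower parameter `C` (`C` not zero or a negative integer).
By the identity theorem `F` is uniquely determined on the cut plane. -/
def IsHyp2F1 (A B C : ℂ) (F : ℂ → ℂ) : Prop :=
  AnalyticOnNhd ℂ F cutPlane ∧
    ∀ z : ℂ, ‖z‖ < 1 → F z = ordinaryHypergeometric A B C z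

/-- The rising factorial `(x)_k = x (x + 1) ⋯ (x + k - 1)`. -/
noncomputable def risingFact (x : ℂ) (k : ℕ) : ℂ := (ascPochhammer ℂ k).eval x

/-- The hypergeometric series with three upper and two lower parameters, at the point `1`. -/
noncomputable def hyp3F2 (A B C D E : ℂ) : ℂ :=
  ∑' k : ℕ, risingFact A k * risingFact B k * risingFact C k /
    (risingFact D k * risingFact E k * (k.factorial : ℂ))

/-- The series is a well-defined finite sum: an upper parameter is `-m` with `m` a natural
number, so that no term beyond the index `m` occurs, and no denominator vanishes up to there. -/
def Terminates3F2 (A B C D E : ℂ) : Prop :=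
  ∃ m : ℕ, (A = -(m : ℂ) ∨ B = -(m : ℂ) ∨ C = -(m : ℂ)) ∧
    ∀ k ≤ m, risingFact D k ≠ 0 ∧ risingFact E k ≠ 0

/-- The coefficient `P(n)`. -/
noncomputable def coeffP (n : ℤ) (a b : ℂ) : ℂ :=
  1 / (2 : ℂ) ^ (n + 1) *
    hyp3F2 (-(n : ℂ) / 2) (-((n : ℂ) + 1) / 2) (a / 2 - b) (1 / 2) (a / 2)

/-- The coefficient `Q(n)`. -/
noncomputable def coeffQ (n : ℤ) (a b : ℂ) : ℂ :=
  ((n : ℂ) + 1) / (2 : ℂ) ^ (n + 1) *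
    hyp3F2 (-((n : ℂ) - 1) / 2) (-(n : ℂ) / 2) ((a + 1) / 2 - b) (3 / 2) ((a + 1) / 2)

/-- The first `Γ`-term. Mathlib's `Gamma` is `0` at its poles and `x / 0 = 0`, so a pole of a
`Γ` in the denominator is read correctly as `1 / Γ = 0`. -/
noncomputable def gammaTermP (a b : ℂ) : ℂ :=
  Gamma (a - b) * Gamma ((a + 1) / 2) / (Gamma a * Gamma ((a + 1) / 2 - b))

/-- The second `Γ`-term. -/
noncomputable def gammaTermQ (a b : ℂ) : ℂ :=
  Gamma (a - b) * Gamma (a / 2) / (Gamma a * Gamma (a / 2 - b))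

/-! Put N = n + 1 and let f(N) be the value at -1 of the continued series with parameters a - 1 + N,
b; a - b. Gauss's contiguous relation in the first parameter (`contiguous_left`) is a three-term
recurrence for f, whose leading coefficient is a nonzero multiple of a + N at the step to f(N + 2).
So f is determined by f(0) and f(1).

Both come from Kummer's theorem: f(0) is a Kummer value U, and `two_mul_eq` gives 2 f(1) = U + V,
with V twice another Kummer value. Legendre duplication identifies U and V with the Γ-terms away
from their removable singularities.

On the other side, the products of rising factorials in P and Q collapse to binomial coefficients.
Hence P U + Q V is 2^(-N) times the sum of choose(N, j) g(j), where the even and odd terms of g come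
from P and Q and (a + j) g(j + 2) = (a + j - 2b) g(j). Pascal's rule turns this two-step relation
into the same recurrence in N (`binomialTransform_recurrence`), and the initial values agree.

Every relation between continued functions is checked on Taylor coefficients at 0 and carried to -1
by the identity theorem (`three_term`). The auxiliary continuations it needs exist by Euler's
integral. -/

/-! ### Rising factorials and series coefficients -/

theorem risingFact_zero (x : ℂ) : risingFact x 0 = 1 := by simp [risingFact]

theorem risingFact_succ (x : ℂ) (k : ℕ) : risingFact x (k + 1) = risingFact x k * (x + k) := by
  simp [risingFact, ascPochhammer_succ_eval]

theorem risingFact_succ_left (x : ℂ) (k : ℕ) :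
    risingFact x (k + 1) = x * risingFact (x + 1) k := by
  simp [risingFact, ascPochhammer_succ_left, Polynomial.eval_comp]

theorem risingFact_sub_one_succ (x : ℂ) (k : ℕ) :
    risingFact (x - 1) (k + 1) = (x - 1) * risingFact x k := by
  rw [risingFact_succ_left, sub_add_cancel]

theorem risingFact_eq_zero_iff (x : ℂ) (k : ℕ) :
    risingFact x k = 0 ↔ ∃ j < k, x = -(j : ℂ) := by
  rw [risingFact, ascPochhammer_eval_eq_zero_iff]
  refine exists_congr fun j => and_congr_right fun _ => ?_
  constructor <;> intro h
  · rw [h, neg_neg]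
  · rw [h, neg_neg]

/-- `x` is neither zero nor a negative integer. -/
def NotPole (x : ℂ) : Prop := ∀ m : ℕ, x ≠ -(m : ℂ)

theorem NotPole.add_one {x : ℂ} (h : NotPole x) : NotPole (x + 1) := fun m hm =>
  h (m + 1) (by push_cast; linear_combination hm)

theorem NotPole.ne_zero {x : ℂ} (h : NotPole x) : x ≠ 0 := by simpa using h 0

theorem NotPole.add_nat_ne_zero {x : ℂ} (h : NotPole x) (k : ℕ) : x + k ≠ 0 := fun hk =>
  h k (eq_neg_of_add_eq_zero_left hk)

theorem NotPole.risingFact_ne_zero {x : ℂ} (h : NotPole x) (k : ℕ) : risingFact x k ≠ 0 := by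
  rw [Ne, risingFact_eq_zero_iff]
  rintro ⟨j, -, hj⟩
  exact h j hj

/-- The coefficients of the Gauss hypergeometric series. -/
noncomputable def hypCoeff (A B C : ℂ) (k : ℕ) : ℂ :=
  risingFact A k * risingFact B k / (risingFact C k * (k.factorial : ℂ))

theorem hypCoeff_zero (A B C : ℂ) : hypCoeff A B C 0 = 1 := by simp [hypCoeff, risingFact_zero]

theorem hypCoeff_comm (A B C : ℂ) : hypCoeff A B C = hypCoeff B A C := by
  ext k; simp [hypCoeff, mul_comm]

/-! ### Power series continued to the cut plane -/

/-- The function `F` is analytic on the cut plane and has the power series with coefficients `c`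
on the unit disc. -/
def IsContinuation (c : ℕ → ℂ) (F : ℂ → ℂ) : Prop :=
  AnalyticOnNhd ℂ F cutPlane ∧ ∀ z : ℂ, ‖z‖ < 1 → HasSum (fun k => c k * z ^ k) (F z)

/-- The coefficients of a power series multiplied by the variable. -/
def shiftCoeff (c : ℕ → ℂ) : ℕ → ℂ
  | 0 => 0
  | k + 1 => c k

theorem mem_cutPlane_iff (z : ℂ) : z ∈ cutPlane ↔ 1 - z ∈ slitPlane := by
  simp only [cutPlane, Set.mem_ofPred_eq, mem_slitPlane_iff, sub_re, sub_im, one_re, one_im]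
  constructor
  · intro h
    by_cases h1 : z.im = 0
    · left; by_contra h2; exact h ⟨h1, by linarith⟩
    · right; simpa using h1
  · rintro (h | h) ⟨h1, h2⟩
    · linarith
    · simp [h1] at h

theorem one_sub_real_mul_mem_slitPlane {z : ℂ} (hz : z ∈ cutPlane) {t : ℝ} (ht : 0 ≤ t)
    (ht1 : t ≤ 1) : 1 - (t : ℂ) * z ∈ slitPlane := by
  rw [mem_cutPlane_iff, mem_slitPlane_iff] at hz
  rw [mem_slitPlane_iff]
  simp only [sub_re, sub_im, one_re, one_im, mul_re, mul_im, ofReal_re, ofReal_im] at hz ⊢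
  rcases ht.eq_or_lt with rfl | ht
  · simp
  rcases hz with h | h
  · left; nlinarith
  · right
    have : z.im ≠ 0 := by simpa using h
    simpa using ⟨ht.ne', this⟩

theorem isOpen_cutPlane : IsOpen cutPlane := by
  have : cutPlane = (fun z : ℂ => 1 - z) ⁻¹' slitPlane := by
    ext z; exact mem_cutPlane_iff z
  rw [this]
  exact isOpen_slitPlane.preimage (by fun_prop)

theorem zero_mem_cutPlane : (0 : ℂ) ∈ cutPlane := by simp [mem_cutPlane_iff]

theorem neg_one_mem_cutPlane : (-1 : ℂ) ∈ cutPlane := by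
  rw [mem_cutPlane_iff, mem_slitPlane_iff]
  left; norm_num

theorem isPreconnected_cutPlane : IsPreconnected cutPlane := by
  -- The cut lies on a ray pointing away from 0, so the cut plane is star-shaped about 0.
  have : StarConvex ℝ (0 : ℂ) cutPlane := by
    rw [starConvex_zero_iff]
    intro z hz t ht ht1
    rw [mem_cutPlane_iff]
    simpa using one_sub_real_mul_mem_slitPlane hz ht ht1
  exact (this.isPathConnected zero_mem_cutPlane).isConnected.isPreconnected

theorem eqOn_cutPlane {F G : ℂ → ℂ} (hF : AnalyticOnNhd ℂ F cutPlane)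
    (hG : AnalyticOnNhd ℂ G cutPlane) (h : ∀ z : ℂ, ‖z‖ < 1 → F z = G z) :
    Set.EqOn F G cutPlane := by
  refine hF.eqOn_of_preconnected_of_eventuallyEq hG isPreconnected_cutPlane zero_mem_cutPlane ?_
  filter_upwards [Metric.ball_mem_nhds (0 : ℂ) one_pos] with z hz
  exact h z (by simpa using hz)

namespace IsContinuation

variable {c d e : ℕ → ℂ} {F G H : ℂ → ℂ}

theorem unique (hF : IsContinuation c F) (hG : IsContinuation c G) :
    Set.EqOn F G cutPlane :=
  eqOn_cutPlane hF.1 hG.1 fun z hz => (hF.2 z hz).unique (hG.2 z hz)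

theorem add (hF : IsContinuation c F) (hG : IsContinuation d G) :
    IsContinuation (c + d) (F + G) :=
  ⟨hF.1.add hG.1, fun z hz => by simpa [add_mul] using! (hF.2 z hz).add (hG.2 z hz)⟩

theorem const_mul (hF : IsContinuation c F) (p : ℂ) :
    IsContinuation (fun k => p * c k) (fun z => p * F z) :=
  ⟨analyticOnNhd_const.mul hF.1,
    fun z hz => by simpa [mul_assoc] using (hF.2 z hz).mul_left p⟩

theorem id_mul (hF : IsContinuation c F) :
    IsContinuation (shiftCoeff c) (fun z => z * F z) := by
  refine ⟨analyticOnNhd_id.mul hF.1, fun z hz => ?_⟩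
  rw [← hasSum_nat_add_iff' 1]
  simpa [shiftCoeff, pow_succ, mul_comm, mul_left_comm, mul_assoc] using (hF.2 z hz).mul_left z

theorem linear_mul (hF : IsContinuation c F) (p q : ℂ) :
    IsContinuation (fun k => p * c k + q * shiftCoeff c k) (fun z => (p + q * z) * F z) := by
  have := (hF.const_mul p).add (hF.id_mul.const_mul q)
  convert this using 1
  · ext z; simp only [Pi.add_apply]
  · ext z; simp only [Pi.add_apply]; ring

theorem congr_coeff (hF : IsContinuation c F) (h : ∀ k, c k = d k) : IsContinuation d F :=
  (funext h : c = d) ▸ hF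

/-- A linear relation between the coefficients of three power series, with coefficients of degree
at most one, gives a relation between their analytic continuations. -/
theorem three_term (hF : IsContinuation c F) (hG : IsContinuation d G) (hH : IsContinuation e H)
    {p q r s t u : ℂ} (h0 : p * c 0 + r * d 0 + t * e 0 = 0)
    (h1 : ∀ k, p * c (k + 1) + q * c k + (r * d (k + 1) + s * d k) +
      (t * e (k + 1) + u * e k) = 0) {z : ℂ} (hz : z ∈ cutPlane) :
    (p + q * z) * F z + (r + s * z) * G z + (t + u * z) * H z = 0 := by
  have h := ((hF.linear_mul p q).add (hG.linear_mul r s)).add (hH.linear_mul t u)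
  have hzero : IsContinuation (fun _ => 0) (fun _ => 0) :=
    ⟨analyticOnNhd_const, fun z _ => by simp [hasSum_zero]⟩
  have := (h.congr_coeff (d := fun _ => 0) ?_).unique hzero hz
  · simpa using this
  · rintro (_ | k)
    · simpa [shiftCoeff] using h0
    · simpa [shiftCoeff] using h1 k

end IsContinuation

/-! ### Relations between neighbouring Gauss series -/

/-- `F` is the analytic continuation of the Gauss hypergeometric series, which converges on the
unit disc. -/
abbrev IsHyp (A B C : ℂ) (F : ℂ → ℂ) : Prop := IsContinuation (hypCoeff A B C) F

/-- Both series on the right have a larger `B`, and `C - B` does not decrease: this extends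
existence to smaller real parts of `B`. -/
theorem hypCoeff_eq_lower_left {A B C : ℂ} (hC : NotPole C) (k : ℕ) :
    hypCoeff A B C k = hypCoeff A (B + 1) (C + 1) k +
      (-(A * (C - B) / (C * (C + 1)))) * shiftCoeff (hypCoeff (A + 1) (B + 1) (C + 2)) k := by
  have hC2 : C + 2 = C + 1 + 1 := by ring
  rcases k with _ | j
  · simp [hypCoeff_zero, shiftCoeff]
  · have h1 := hC.add_one.add_nat_ne_zero j
    have h2 := hC.add_one.add_one.risingFact_ne_zero j
    have h3 := hC.ne_zero
    have h4 := hC.add_one.ne_zero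
    have h5 : (j : ℂ) + 1 ≠ 0 := by exact_mod_cast j.succ_ne_zero
    have h6 : (j.factorial : ℂ) ≠ 0 := by exact_mod_cast j.factorial_ne_zero
    have h7 : risingFact (C + 1) j = (C + 1) * risingFact (C + 1 + 1) j / (C + 1 + j) := by
      rw [eq_div_iff h1, ← risingFact_succ, risingFact_succ_left]
    simp only [hypCoeff, shiftCoeff, hC2]
    rw [risingFact_succ_left A, risingFact_succ_left B, risingFact_succ_left C,
      risingFact_succ (B + 1), risingFact_succ_left (C + 1), h7, Nat.factorial_succ]
    push_cast
    field_simp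
    ring

/-- Both series on the right have `C - B` larger by one: this extends existence to smaller real
parts of `C - B`. -/
theorem hypCoeff_eq_raise_lower {A B C : ℂ} (hC : NotPole C) (k : ℕ) :
    hypCoeff A B C k = hypCoeff A B (C + 1) k +
      (A * B / (C * (C + 1))) * shiftCoeff (hypCoeff (A + 1) (B + 1) (C + 2)) k := by
  have hC2 : C + 2 = C + 1 + 1 := by ring
  rcases k with _ | j
  · simp [hypCoeff_zero, shiftCoeff]
  · have h1 := hC.add_one.add_nat_ne_zero j
    have h2 := hC.add_one.add_one.risingFact_ne_zero j
    have h3 := hC.ne_zero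
    have h4 := hC.add_one.ne_zero
    have h5 : (j : ℂ) + 1 ≠ 0 := by exact_mod_cast j.succ_ne_zero
    have h6 : (j.factorial : ℂ) ≠ 0 := by exact_mod_cast j.factorial_ne_zero
    have h7 : risingFact (C + 1) j = (C + 1) * risingFact (C + 1 + 1) j / (C + 1 + j) := by
      rw [eq_div_iff h1, ← risingFact_succ, risingFact_succ_left]
    simp only [hypCoeff, shiftCoeff, hC2]
    rw [risingFact_succ_left A, risingFact_succ_left B, risingFact_succ_left C,
      risingFact_succ_left (C + 1), h7, Nat.factorial_succ]
    push_cast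
    field_simp
    ring

namespace IsContinuation

variable {A B C : ℂ} {F G H : ℂ → ℂ}

/-- The auxiliary function `H` enters with the factor 1 + z, so it drops out at -1 and leaves a
two-term relation inside Kummer's family. -/
theorem kummer_shift_right (hF : IsHyp A B (1 + A - B) F) (hG : IsHyp A (B - 1) (2 + A - B) G)
    (hH : IsHyp (A + 1) B (2 + A - B) H) (hC : NotPole (1 + A - B)) :
    (1 + A - B) * F (-1) = (1 + A / 2 - B) * G (-1) := by
  have key := hF.three_term hG hH (p := 1 + A - B) (q := 0) (r := -(1 + A / 2 - B)) (s := 0)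
    (t := -(A / 2)) (u := -(A / 2)) (by simp only [hypCoeff_zero]; ring) (fun j => ?_)
    neg_one_mem_cutPlane
  · linear_combination key
  -- `C` stays opaque while denominators are cleared; its value is needed only for the final
  -- polynomial identity.
  · obtain ⟨C, hCd⟩ : ∃ C, C = 1 + A - B := ⟨_, rfl⟩
    rw [show 2 + A - B = C + 1 by rw [hCd]; ring]
    rw [← hCd] at hC ⊢
    have h0 := hC.ne_zero
    have h1 := hC.add_one.add_nat_ne_zero j
    have h2 := hC.add_one.risingFact_ne_zero j
    have h5 : (j : ℂ) + 1 ≠ 0 := by exact_mod_cast j.succ_ne_zero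
    have h6 : (j.factorial : ℂ) ≠ 0 := by exact_mod_cast j.factorial_ne_zero
    simp only [hypCoeff]
    rw [risingFact_succ_left A, risingFact_sub_one_succ B, risingFact_succ_left C,
      risingFact_succ B, risingFact_succ (A + 1), risingFact_succ (C + 1), Nat.factorial_succ]
    push_cast
    field_simp
    rw [hCd]
    ring

/-- Again `H` carries the factor 1 + z, while the factor 1 - z of `G` produces the 2. -/
theorem kummer_shift_both (hF : IsHyp A B (1 + A - B) F)
    (hG : IsHyp (A + 2) (B + 1) (2 + A - B) G)
    (hH : IsHyp (A + 1) (B + 1) (2 + A - B) H) (hC : NotPole (1 + A - B)) :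
    (1 + A - B) * F (-1) = 2 * (A + 1) * G (-1) := by
  have key := hF.three_term hG hH (p := 1 + A - B) (q := 0) (r := -(A + 1)) (s := A + 1)
    (t := B) (u := B) (by simp only [hypCoeff_zero]; ring) (fun j => ?_)
    neg_one_mem_cutPlane
  · linear_combination key
  · obtain ⟨C, hCd⟩ : ∃ C, C = 1 + A - B := ⟨_, rfl⟩
    rw [show 2 + A - B = C + 1 by rw [hCd]; ring, show A + 2 = A + 1 + 1 by ring]
    rw [← hCd] at hC ⊢
    have h0 := hC.ne_zero
    have h1 := hC.add_one.add_nat_ne_zero j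
    have h2 := hC.add_one.risingFact_ne_zero j
    have h5 : (j : ℂ) + 1 ≠ 0 := by exact_mod_cast j.succ_ne_zero
    have h6 : (j.factorial : ℂ) ≠ 0 := by exact_mod_cast j.factorial_ne_zero
    have h8 : (A + 1) * risingFact (A + 1 + 1) j = risingFact (A + 1) j * (A + 1 + j) := by
      rw [← risingFact_succ_left, risingFact_succ]
    simp only [hypCoeff]
    rw [risingFact_succ_left A, risingFact_succ_left B, risingFact_succ_left C,
      risingFact_succ (B + 1), risingFact_succ (A + 1), risingFact_succ (A + 1 + 1),
      risingFact_succ (C + 1), Nat.factorial_succ]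
    push_cast
    field_simp
    rw [hCd]
    linear_combination (risingFact (B + 1) j * ((j + 1) * (1 + A - B + 1 + j) -
      (A + 1 + 1 + j) * (B + 1 + j))) * h8

theorem contiguous_left (hF : IsHyp (A - 1) B C F) (hG : IsHyp A B C G)
    (hH : IsHyp (A + 1) B C H) (hC : NotPole C) {z : ℂ} (hz : z ∈ cutPlane) :
    (C - A) * F z + (2 * A - C + (B - A) * z) * G z + A * (z - 1) * H z = 0 := by
  have key := hF.three_term hG hH (p := C - A) (q := 0) (r := 2 * A - C) (s := B - A)
    (t := -A) (u := A) (by simp only [hypCoeff_zero]; ring) (fun j => ?_) hz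
  · linear_combination key
  · have h1 := hC.add_nat_ne_zero j
    have h2 := hC.risingFact_ne_zero j
    have h5 : (j : ℂ) + 1 ≠ 0 := by exact_mod_cast j.succ_ne_zero
    have h6 : (j.factorial : ℂ) ≠ 0 := by exact_mod_cast j.factorial_ne_zero
    -- `A` may vanish, so the two factorials are linked by a product identity and not by a quotient.
    have h8 : A * risingFact (A + 1) j = risingFact A j * (A + j) := by
      rw [← risingFact_succ_left, risingFact_succ]
    simp only [hypCoeff]
    rw [risingFact_succ A, risingFact_sub_one_succ A, risingFact_succ C,
      risingFact_succ B, risingFact_succ (A + 1), Nat.factorial_succ]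
    push_cast
    field_simp
    linear_combination (risingFact B j * ((j + 1) * (C + j) - (A + 1 + j) * (B + j))) * h8

theorem two_mul_eq (hF : IsHyp A B (A - B) F) (hG : IsHyp (A - 1) B (A - B) G)
    (hH : IsHyp A (B + 1) (A - B) H) (hC : NotPole (A - B)) {z : ℂ} (hz : z ∈ cutPlane) :
    2 * F z = G z + (1 - z) * H z := by
  have key := hF.three_term hG hH (p := 2) (q := 0) (r := -1) (s := 0)
    (t := -1) (u := 1) (by simp only [hypCoeff_zero]; ring) (fun j => ?_) hz
  · linear_combination key
  · have h1 := hC.add_nat_ne_zero j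
    have h2 := hC.risingFact_ne_zero j
    have h5 : (j : ℂ) + 1 ≠ 0 := by exact_mod_cast j.succ_ne_zero
    have h6 : (j.factorial : ℂ) ≠ 0 := by exact_mod_cast j.factorial_ne_zero
    simp only [hypCoeff]
    rw [risingFact_succ A, risingFact_sub_one_succ A, risingFact_succ (A - B),
      risingFact_succ_left B, risingFact_succ (B + 1), Nat.factorial_succ]
    push_cast
    field_simp
    ring

end IsContinuation

/-! ### Euler's integral and existence of the continuation -/

-- Differentiation under the integral sign: near a point of the cut plane the z-derivative of the
-- kernel is bounded uniformly in t, by compactness, so a multiple of the norm of `φ` dominates.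
open MeasureTheory in
theorem analyticOnNhd_eulerIntegral {φ : ℝ → ℂ} (hφ : IntervalIntegrable φ volume 0 1) (A : ℂ) :
    AnalyticOnNhd ℂ (fun z => ∫ t in (0 : ℝ)..1, φ t * (1 - (t : ℂ) * z) ^ (-A)) cutPlane := by
  refine DifferentiableOn.analyticOnNhd (fun z₀ hz₀ => ?_) isOpen_cutPlane
  obtain ⟨K, hK, hzK, hKsub⟩ := exists_compact_subset isOpen_cutPlane hz₀
  have hslit : ∀ t ∈ Set.Icc (0 : ℝ) 1, ∀ z ∈ cutPlane, 1 - (t : ℂ) * z ∈ slitPlane :=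
    fun t ht z hz => one_sub_real_mul_mem_slitPlane hz ht.1 ht.2
  have hcont : ∀ z ∈ cutPlane, ∀ B : ℂ,
      ContinuousOn (fun t : ℝ => (1 - (t : ℂ) * z) ^ B) (Set.uIcc 0 1) := by
    intro z hz B
    rw [Set.uIcc_of_le zero_le_one]
    refine ContinuousOn.cpow_const (by fun_prop) fun t ht => hslit t ht z hz
  obtain ⟨M, hM⟩ : ∃ M : ℝ, ∀ t ∈ Set.Icc (0 : ℝ) 1, ∀ z ∈ K,
      ‖-A * (1 - (t : ℂ) * z) ^ (-A - 1) * -(t : ℂ)‖ ≤ M := by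
    have hc : ContinuousOn
        (fun p : ℝ × ℂ => -A * (1 - (p.1 : ℂ) * p.2) ^ (-A - 1) * -(p.1 : ℂ))
        (Set.Icc (0 : ℝ) 1 ×ˢ K) := by
      refine ContinuousOn.mul (ContinuousOn.mul continuousOn_const
        (ContinuousOn.cpow_const (by fun_prop) ?_)) (by fun_prop)
      rintro ⟨t, z⟩ ⟨ht, hz⟩
      exact hslit t ht z (hKsub hz)
    obtain ⟨M, hM⟩ := (isCompact_Icc.prod hK).exists_bound_of_continuousOn hc
    exact ⟨M, fun t ht z hz => hM (t, z) ⟨ht, hz⟩⟩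
  have hcut : ∀ᶠ z in 𝓝 z₀, z ∈ cutPlane := isOpen_cutPlane.mem_nhds hz₀
  have hIoc : ∀ t ∈ Set.uIoc (0 : ℝ) 1, t ∈ Set.Icc (0 : ℝ) 1 := fun t ht => by
    rw [Set.uIoc_of_le zero_le_one] at ht
    exact Set.Ioc_subset_Icc_self ht
  have hmeas : ∀ {f : ℝ → ℂ}, IntervalIntegrable f volume 0 1 →
      AEStronglyMeasurable f (volume.restrict (Set.uIoc 0 1)) := fun hf =>
    (intervalIntegrable_iff.1 hf).aestronglyMeasurable
  refine (intervalIntegral.hasDerivAt_integral_of_dominated_loc_of_deriv_le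
    (F' := fun z t => φ t * (-A * (1 - (t : ℂ) * z) ^ (-A - 1) * -(t : ℂ)))
    (bound := fun t => ‖φ t‖ * M) (mem_interior_iff_mem_nhds.1 hzK) ?_ ?_ ?_ ?_ ?_
    ?_).2.differentiableAt.differentiableWithinAt
  · filter_upwards [hcut] with z hz
    exact hmeas (hφ.mul_continuousOn (hcont z hz _))
  · exact hφ.mul_continuousOn (hcont z₀ hz₀ _)
  · refine hmeas (hφ.mul_continuousOn ?_)
    exact (continuousOn_const.mul (hcont z₀ hz₀ _)).mul (by fun_prop)
  · refine Eventually.of_forall fun t ht z hz => ?_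
    rw [norm_mul]
    gcongr
    exact hM t (hIoc t ht) z hz
  · exact hφ.norm.mul_const M
  · refine Eventually.of_forall fun t ht z hz => HasDerivAt.const_mul _ ?_
    have h1 : HasDerivAt (fun z : ℂ => 1 - (t : ℂ) * z) (-(t : ℂ)) z := by
      simpa using ((hasDerivAt_id z).const_mul (t : ℂ)).const_sub 1
    exact h1.cpow_const (hslit t (hIoc t ht) z (hKsub hz))

theorem hasSum_one_sub_cpow_neg (A : ℂ) {z : ℂ} (hz : ‖z‖ < 1) :
    HasSum (fun k : ℕ => risingFact A k / (k.factorial : ℂ) * z ^ k) ((1 - z) ^ (-A)) := by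
  have h := (one_add_cpow_hasFPowerSeriesOnBall_zero (a := -A)).hasSum (y := -z)
    (by simpa [← ofReal_norm, ENNReal.ofReal_lt_one] using hz)
  -- The parameter `b` occurs both above and below and cancels; 1 is an admissible choice.
  rw [binomialSeries_eq_ordinaryHypergeometricSeries (b := (1 : ℂ))
    (fun k hk => by
      have : ((k + 1 : ℕ) : ℂ) = 0 := by push_cast; rw [hk]; ring
      exact absurd (Nat.cast_eq_zero.1 this) k.succ_ne_zero)] at h
  rw [zero_add, ← sub_eq_add_neg] at h
  refine (congrArg (fun f : ℕ → ℂ => HasSum f _) (funext fun k => ?_)).mp h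
  · have h1 : (ascPochhammer ℂ k).eval 1 = (k.factorial : ℂ) := by simp
    have h6 : (k.factorial : ℂ) ≠ 0 := by exact_mod_cast k.factorial_ne_zero
    simp only [FormalMultilinearSeries.compContinuousLinearMap_apply]
    have : ((-ContinuousLinearMap.id ℂ ℂ : ℂ →L[ℂ] ℂ) ∘ fun _ : Fin k => -z) = fun _ => z := by
      ext; simp
    rw [this, ordinaryHypergeometricSeries_apply_eq, h1, neg_neg, risingFact]
    simp only [smul_eq_mul]
    field_simp

theorem risingFact_mul_Gamma {x : ℂ} (hx : NotPole x) (k : ℕ) :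
    risingFact x k * Gamma x = Gamma (x + k) := by
  induction k with
  | zero => simp [risingFact_zero]
  | succ k ih =>
    rw [risingFact_succ, mul_right_comm, ih]
    push_cast
    rw [← add_assoc, Gamma_add_one _ (hx.add_nat_ne_zero k)]
    ring

theorem notPole_of_re_pos {x : ℂ} (hx : 0 < x.re) : NotPole x := fun m hm => by
  rw [hm] at hx
  simp at hx
  linarith [Nat.cast_nonneg (α := ℝ) m]

-- Expand the kernel by the binomial series and integrate termwise, which is allowed because |tz| ≤
-- |z| < 1; each term is then a Beta integral.
open MeasureTheory in
theorem isHyp_eulerIntegral (A : ℂ) {B C : ℂ} (hB : 0 < B.re) (hCB : 0 < (C - B).re) :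
    IsHyp A B C fun z => Gamma C / (Gamma B * Gamma (C - B)) *
      ∫ t in (0 : ℝ)..1, ((t : ℂ) ^ (B - 1) * (1 - (t : ℂ)) ^ (C - B - 1)) *
        (1 - (t : ℂ) * z) ^ (-A) := by
  have hφ := betaIntegral_convergent hB hCB
  refine ⟨analyticOnNhd_const.mul (analyticOnNhd_eulerIntegral hφ A), fun z hz => ?_⟩
  have hIoc : ∀ t ∈ Set.Ioc (0 : ℝ) 1, 0 < t ∧ ‖(t : ℂ) * z‖ ≤ ‖z‖ := fun t ht => by
    refine ⟨ht.1, ?_⟩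
    rw [norm_mul, Complex.norm_real, Real.norm_of_nonneg ht.1.le]
    exact mul_le_of_le_one_left (norm_nonneg _) ht.2
  have hC : NotPole C := notPole_of_re_pos (by simp at hCB; linarith)
  set φ : ℝ → ℂ := fun t => (t : ℂ) ^ (B - 1) * (1 - (t : ℂ)) ^ (C - B - 1) with hφd
  have hφ' := (intervalIntegrable_iff_integrableOn_Ioc_of_le zero_le_one).1 hφ
  have hint : ∀ k : ℕ, IntegrableOn
      (fun t : ℝ => φ t * (risingFact A k / (k.factorial : ℂ) * ((t : ℂ) * z) ^ k))
      (Set.Ioc 0 1) := fun k => by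
    rw [← intervalIntegrable_iff_integrableOn_Ioc_of_le zero_le_one]
    exact hφ.mul_continuousOn (by fun_prop)
  have hsum : HasSum (fun k : ℕ => ∫ t in Set.Ioc (0 : ℝ) 1,
      φ t * (risingFact A k / (k.factorial : ℂ) * ((t : ℂ) * z) ^ k))
      (∫ t in Set.Ioc (0 : ℝ) 1, φ t * (1 - (t : ℂ) * z) ^ (-A)) := by
    have key := hasSum_integral_of_summable_integral_norm hint ?_
    · rw [setIntegral_congr_fun (g := fun t : ℝ => φ t * (1 - (t : ℂ) * z) ^ (-A))
        measurableSet_Ioc fun t ht => (((hasSum_one_sub_cpow_neg A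
          ((hIoc t ht).2.trans_lt hz)).mul_left (φ t)).tsum_eq)] at key
      exact key
    · refine Summable.of_nonneg_of_le (fun k => integral_nonneg fun t : ℝ => norm_nonneg
        (φ t * (risingFact A k / (k.factorial : ℂ) * ((t : ℂ) * z) ^ k))) (fun k => ?_)
        ((hasSum_one_sub_cpow_neg A hz).summable.norm.mul_left (∫ t in Set.Ioc (0 : ℝ) 1, ‖φ t‖))
      rw [← integral_mul_const]
      refine setIntegral_mono_on (hint k).norm (hφ'.norm.mul_const _) measurableSet_Ioc
        fun t ht => ?_
      rw [norm_mul (φ t), norm_mul (_ / _), norm_mul (_ / _), norm_pow, norm_pow]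
      gcongr
      exact (hIoc t ht).2
  simp only [intervalIntegral.integral_of_le zero_le_one]
  have h := hsum.mul_left (Gamma C / (Gamma B * Gamma (C - B)))
  refine (congrArg (fun f : ℕ → ℂ => HasSum f _) (funext fun k => ?_)).mp h
  have hBk : 0 < (B + k).re := by rw [add_re, natCast_re]; positivity
  have hbeta : ∫ t in Set.Ioc (0 : ℝ) 1,
      φ t * (risingFact A k / (k.factorial : ℂ) * ((t : ℂ) * z) ^ k) =
      risingFact A k / (k.factorial : ℂ) * z ^ k * betaIntegral (B + k) (C - B) := by
    rw [betaIntegral, intervalIntegral.integral_of_le zero_le_one, ← integral_const_mul]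
    refine setIntegral_congr_fun measurableSet_Ioc fun t ht => ?_
    have : (t : ℂ) ^ (B + k - 1) = (t : ℂ) ^ (B - 1) * (t : ℂ) ^ k := by
      rw [← cpow_natCast, ← cpow_add _ _ (by exact_mod_cast ht.1.ne')]
      ring_nf
    simp only [hφd, this, mul_pow]
    ring
  rw [hbeta, betaIntegral_eq_Gamma_mul_div _ _ hBk hCB, show B + k + (C - B) = C + k by ring,
    ← risingFact_mul_Gamma hC, ← risingFact_mul_Gamma (notPole_of_re_pos hB), hypCoeff]
  have h1 := Gamma_ne_zero hC
  have h2 := Gamma_ne_zero_of_re_pos hB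
  have h3 := Gamma_ne_zero_of_re_pos hCB
  have h4 := hC.risingFact_ne_zero k
  field_simp

theorem exists_isHyp_of_re_sub_pos (m : ℕ) : ∀ A B C : ℂ, NotPole C → -(m : ℝ) < B.re →
    0 < (C - B).re → ∃ F, IsHyp A B C F := by
  induction m with
  | zero => exact fun A B C _ hB hCB => ⟨_, isHyp_eulerIntegral A (by simpa using hB) hCB⟩
  | succ m ih =>
    intro A B C hC hB hCB
    push_cast at hB
    simp only [sub_re] at hCB
    obtain ⟨F, hF⟩ := ih A (B + 1) (C + 1) hC.add_one (by simp; linarith) (by simp; linarith)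
    obtain ⟨G, hG⟩ := ih (A + 1) (B + 1) (C + 2)
      (by simpa [add_assoc, one_add_one_eq_two] using hC.add_one.add_one)
      (by simp; linarith) (by simp; linarith)
    exact ⟨_, (hF.add (hG.id_mul.const_mul _)).congr_coeff fun k =>
      (hypCoeff_eq_lower_left hC k).symm⟩

theorem exists_isHyp_of_re_sub_gt (m : ℕ) : ∀ A B C : ℂ, NotPole C → -(m : ℝ) < (C - B).re →
    ∃ F, IsHyp A B C F := by
  induction m with
  | zero =>
    intro A B C hC hCB
    obtain ⟨m, hm⟩ := exists_nat_gt (-B.re)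
    exact exists_isHyp_of_re_sub_pos m A B C hC (by linarith) (by simpa using hCB)
  | succ m ih =>
    intro A B C hC hCB
    push_cast at hCB
    simp only [sub_re] at hCB
    obtain ⟨F, hF⟩ := ih A B (C + 1) hC.add_one (by simp; linarith)
    obtain ⟨G, hG⟩ := ih (A + 1) (B + 1) (C + 2)
      (by simpa [add_assoc, one_add_one_eq_two] using hC.add_one.add_one) (by simp; linarith)
    exact ⟨_, (hF.add (hG.id_mul.const_mul _)).congr_coeff fun k =>
      (hypCoeff_eq_raise_lower hC k).symm⟩

/-- The Gauss hypergeometric series has an analytic continuation to the cut plane. -/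
theorem exists_isHyp (A B : ℂ) {C : ℂ} (hC : NotPole C) : ∃ F, IsHyp A B C F := by
  obtain ⟨m, hm⟩ := exists_nat_gt (-(C - B).re)
  exact exists_isHyp_of_re_sub_gt m A B C hC (by linarith)

/-- A `tsum` is 0 when the series diverges, so equality of values must be upgraded to `HasSum`;
convergence on the disc is read off from an existing continuation. -/
theorem isHyp2F1_iff {A B C : ℂ} (hC : NotPole C) (F : ℂ → ℂ) :
    IsHyp2F1 A B C F ↔ IsHyp A B C F := by
  have hterm : ∀ (k : ℕ) (z : ℂ), ((k.factorial : ℂ)⁻¹ * (ascPochhammer ℂ k).eval A *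
      (ascPochhammer ℂ k).eval B * ((ascPochhammer ℂ k).eval C)⁻¹) • z ^ k =
      hypCoeff A B C k * z ^ k := fun k z => by
    simp only [hypCoeff, risingFact, smul_eq_mul, div_eq_mul_inv, mul_inv]; ring
  obtain ⟨G, hG⟩ := exists_isHyp A B hC
  have hval : ∀ z : ℂ, ‖z‖ < 1 → ordinaryHypergeometric A B C z = G z := fun z hz => by
    rw [ordinaryHypergeometric_eq_tsum]
    simp only [hterm]
    exact (hG.2 z hz).tsum_eq
  refine and_congr_right fun _ => forall₂_congr fun z hz => ?_
  rw [hval z hz]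
  exact ⟨fun h => h ▸ hG.2 z hz, fun h => h.unique (hG.2 z hz)⟩

/-! ### Kummer's theorem -/

/-- The value of the Gauss function with parameters `A`, `B`, `1 + A - B` at the point `-1`. -/
noncomputable def kummerValue (A B : ℂ) : ℂ :=
  Gamma (1 + A - B) * (√Real.pi : ℂ) * 2 ^ (-A) * (Gamma ((A + 1) / 2))⁻¹ *
    (Gamma (A / 2 + 1 - B))⁻¹

theorem kummerValue_shift_right (A : ℂ) {B : ℂ} (hC : NotPole (1 + A - B)) :
    (1 + A - B) * kummerValue A B = (1 + A / 2 - B) * kummerValue A (B - 1) := by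
  rw [kummerValue, kummerValue, one_div_Gamma_eq_self_mul_one_div_Gamma_add_one (A / 2 + 1 - B),
    show 1 + A - (B - 1) = 1 + A - B + 1 by ring, Gamma_add_one _ hC.ne_zero,
    show A / 2 + 1 - (B - 1) = A / 2 + 1 - B + 1 by ring]
  ring

theorem kummerValue_shift_both {A B : ℂ} (hC : NotPole (1 + A - B)) :
    (1 + A - B) * kummerValue A B = 2 * (A + 1) * kummerValue (A + 2) (B + 1) := by
  rw [kummerValue, kummerValue, one_div_Gamma_eq_self_mul_one_div_Gamma_add_one ((A + 1) / 2),
    show 1 + (A + 2) - (B + 1) = 1 + A - B + 1 by ring, Gamma_add_one _ hC.ne_zero,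
    show (A + 2) / 2 + 1 - (B + 1) = A / 2 + 1 - B by ring,
    show (A + 2 + 1) / 2 = (A + 1) / 2 + 1 by ring,
    show -A = -(A + 2) + (2 : ℕ) by push_cast; ring, cpow_add _ _ two_ne_zero, cpow_natCast]
  ring

-- The two last factors combine to a power of 1 - t², and s = t² gives a Beta integral. The bounds
-- on `A` and `B` make the integrand in s continuous.
open MeasureTheory in
theorem integral_cpow_mul_one_sub_sq_cpow {A B : ℂ} (hA : 2 < A.re) (hB : B.re < 0) :
    ∫ t in (0 : ℝ)..1, (t : ℂ) ^ (A - 1) * (1 - (t : ℂ)) ^ (-B) * (1 + (t : ℂ)) ^ (-B) =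
      betaIntegral (A / 2) (1 - B) / 2 := by
  have hg : Continuous fun s : ℝ => (s : ℂ) ^ (A / 2 - 1) * (1 - (s : ℂ)) ^ (-B) := by
    have h1 : 0 < (A / 2 - 1).re := by
      rw [sub_re, one_re, show A / 2 = A / (2 : ℝ) by norm_num, div_ofReal_re]; linarith
    have h2 : 0 < (-B).re := by rw [neg_re]; linarith
    have h3 : Continuous fun s : ℝ => ((1 - s : ℝ) : ℂ) ^ (-B) :=
      (continuous_ofReal_cpow_const h2).comp (by fun_prop : Continuous fun s : ℝ => 1 - s)
    push_cast at h3
    exact (continuous_ofReal_cpow_const h1).mul h3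
  have key := intervalIntegral.integral_deriv_smul_comp (a := 0) (b := 1)
    (f := fun t : ℝ => t ^ 2) (f' := fun t => 2 * t) (fun t _ => by simpa using hasDerivAt_pow 2 t)
    (by fun_prop) hg
  rw [betaIntegral, show 1 - B - 1 = -B by ring]
  norm_num at key
  rw [eq_div_iff two_ne_zero, ← key, ← intervalIntegral.integral_mul_const]
  simp only [intervalIntegral.integral_of_le zero_le_one]
  refine setIntegral_congr_fun measurableSet_Ioc fun t ht => ?_
  have ht0 : (t : ℂ) ≠ 0 := by exact_mod_cast ht.1.ne'
  have h1 : ((1 : ℂ) - (t : ℂ) ^ 2) ^ (-B) = (1 - (t : ℂ)) ^ (-B) * (1 + (t : ℂ)) ^ (-B) := by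
    have := mul_cpow_ofReal_nonneg (a := 1 - t) (b := 1 + t) (by linarith [ht.2])
      (by linarith [ht.1]) (-B)
    push_cast at this
    rw [← this]
    ring_nf
  have h2 : ((t : ℂ) ^ 2) ^ (A / 2 - 1) * t = (t : ℂ) ^ (A - 1) := by
    rw [sq, mul_cpow_ofReal_nonneg ht.1.le ht.1.le, ← cpow_add _ _ ht0]
    nth_rewrite 2 [← cpow_one (t : ℂ)]
    rw [← cpow_add _ _ ht0]
    ring_nf
  simp only [h1, ← h2]
  ring

theorem kummer_of_re {A B : ℂ} (hA : 2 < A.re) (hB : B.re < 0) {F : ℂ → ℂ}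
    (hF : IsHyp A B (1 + A - B) F) : F (-1) = kummerValue A B := by
  have hA0 : 0 < A.re := by linarith
  have h1B : 0 < (1 - B).re := by rw [sub_re, one_re]; linarith
  have hC : NotPole (1 + A - B) := notPole_of_re_pos (by simp; linarith)
  have hA2 : 0 < (A / 2).re := by
    rw [show A / 2 = A / (2 : ℝ) by norm_num, div_ofReal_re]; linarith
  -- The upper parameters are exchanged, so that at -1 the kernel becomes (1 + t)^(-B), matching the
  -- weight (1 - t)^(-B).
  have hG := isHyp_eulerIntegral B (B := A) (C := 1 + A - B) hA0 (by simp; linarith)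
  rw [IsHyp, hypCoeff_comm] at hG
  rw [hF.unique hG neg_one_mem_cutPlane]
  simp only [show 1 + A - B - A = 1 - B by ring, show 1 - B - 1 = -B by ring, mul_neg, mul_one,
    sub_neg_eq_add]
  rw [integral_cpow_mul_one_sub_sq_cpow hA hB, betaIntegral_eq_Gamma_mul_div _ _ hA2 h1B,
    kummerValue]
  have hdup := Gamma_mul_Gamma_add_half (A / 2)
  rw [show A / 2 + 1 / 2 = (A + 1) / 2 by ring, show 2 * (A / 2) = A by ring,
    cpow_sub _ _ two_ne_zero, cpow_one] at hdup
  rw [show A / 2 + (1 - B) = A / 2 + 1 - B by ring, cpow_neg]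
  have h1 := Gamma_ne_zero_of_re_pos hA0
  have h2 := Gamma_ne_zero_of_re_pos h1B
  have h3 : Gamma ((A + 1) / 2) ≠ 0 := Gamma_ne_zero_of_re_pos (by
    rw [show (A + 1) / 2 = (A + 1) / (2 : ℝ) by norm_num, div_ofReal_re, add_re, one_re]; linarith)
  have h4 : (2 : ℂ) ^ A ≠ 0 := by simp [cpow_eq_zero_iff]
  generalize Gamma (A / 2 + 1 - B) = x
  field_simp at hdup ⊢
  linear_combination (Gamma (1 + A - B) * x⁻¹) * hdup

/-- Induction lowering `B` by one: the function and the claimed value obey the same shift relation,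
whose left factor 1 + A - B is nonzero. -/
theorem kummer_of_re_left (m : ℕ) : ∀ A B : ℂ, 2 < A.re → B.re < m → NotPole (1 + A - B) →
    ∀ F, IsHyp A B (1 + A - B) F → F (-1) = kummerValue A B := by
  induction m with
  | zero => exact fun A B hA hB _ F hF => kummer_of_re hA (by simpa using hB) hF
  | succ m ih =>
    intro A B hA hB hC F hF
    push_cast at hB
    have hC' : 1 + A - (B - 1) = 1 + A - B + 1 := by ring
    have hC2 : 2 + A - B = 1 + A - B + 1 := by ring
    obtain ⟨G, hG⟩ := exists_isHyp A (B - 1) hC.add_one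
    obtain ⟨H, hH⟩ := exists_isHyp (A + 1) B hC.add_one
    have hG' := ih A (B - 1) hA (by simp; linarith) (hC' ▸ hC.add_one) G (hC' ▸ hG)
    refine mul_left_cancel₀ hC.ne_zero ?_
    rw [kummerValue_shift_right A hC, ← hG']
    exact hF.kummer_shift_right (hC2 ▸ hG) (hC2 ▸ hH) hC

/-- Each step raises `A` by two; `B` grows as well, which is harmless since it is no longer
restricted. -/
theorem kummer_of_re_gt (m : ℕ) : ∀ A B : ℂ, 2 - 2 * (m : ℝ) < A.re → NotPole (1 + A - B) →
    ∀ F, IsHyp A B (1 + A - B) F → F (-1) = kummerValue A B := by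
  induction m with
  | zero =>
    intro A B hA hC F hF
    obtain ⟨m, hm⟩ := exists_nat_gt B.re
    exact kummer_of_re_left m A B (by simpa using hA) hm hC F hF
  | succ m ih =>
    intro A B hA hC F hF
    push_cast at hA
    have hC' : 1 + (A + 2) - (B + 1) = 1 + A - B + 1 := by ring
    have hC2 : 2 + A - B = 1 + A - B + 1 := by ring
    obtain ⟨G, hG⟩ := exists_isHyp (A + 2) (B + 1) hC.add_one
    obtain ⟨H, hH⟩ := exists_isHyp (A + 1) (B + 1) hC.add_one
    have hG' := ih (A + 2) (B + 1) (by simp; linarith) (hC' ▸ hC.add_one) G (hC' ▸ hG)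
    refine mul_left_cancel₀ hC.ne_zero ?_
    rw [kummerValue_shift_both hC, ← hG']
    exact hF.kummer_shift_both (hC2 ▸ hG) (hC2 ▸ hH) hC

/-- **Kummer's theorem**, for the analytic continuation of the Gauss series. -/
theorem kummer {A B : ℂ} (hC : NotPole (1 + A - B)) {F : ℂ → ℂ}
    (hF : IsHyp A B (1 + A - B) F) : F (-1) = kummerValue A B := by
  obtain ⟨m, hm⟩ := exists_nat_gt (2 - A.re)
  exact kummer_of_re_gt m A B (by linarith [Nat.cast_nonneg (α := ℝ) m]) hC F hF

/-! ### Binomial sums and the recurrence -/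

/-- Iterated sums of adjacent terms: `∑ j, N.choose j * g (i + j)`. -/
def binomialTransform (g : ℕ → ℂ) : ℕ → ℕ → ℂ
  | 0, i => g i
  | N + 1, i => binomialTransform g N i + binomialTransform g N (i + 1)

theorem binomialTransform_eq_sum (g : ℕ → ℂ) (N : ℕ) : ∀ i M : ℕ, N < M →
    binomialTransform g N i = ∑ j ∈ Finset.range M, (N.choose j : ℂ) * g (i + j) := by
  induction N with
  | zero =>
    intro i M hM
    obtain ⟨M, rfl⟩ := Nat.exists_eq_succ_of_ne_zero hM.ne'
    simp [Finset.sum_range_succ', binomialTransform]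
  | succ N ih =>
    intro i M hM
    obtain ⟨M, rfl⟩ := Nat.exists_eq_succ_of_ne_zero (Nat.zero_lt_of_lt hM).ne'
    rw [binomialTransform, ih i (M + 1) (by omega), ih (i + 1) M (by omega),
      Finset.sum_range_succ', Finset.sum_range_succ', add_right_comm, ← Finset.sum_add_distrib]
    simp only [Nat.choose_succ_succ, Nat.choose_zero_right, Nat.succ_eq_add_one]
    congr 1
    refine Finset.sum_congr rfl fun j _ => ?_
    rw [show i + 1 + j = i + (j + 1) by ring]
    push_cast
    ring

/-- The offset `i` makes the induction work: the relations for `N` at `i` and `i + 1` add up, by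
Pascal's rule, to the one for `N + 1` at `i`. Only indices from `i` to `i + N` are used, which
matches the nonvanishing available for a + j. -/
theorem binomialTransform_recurrence {g : ℕ → ℂ} {a b : ℂ} (N : ℕ) : ∀ i : ℕ,
    (∀ j, i ≤ j → j ≤ i + N → (a + j) * g (j + 2) = (a + j - 2 * b) * g j) →
    (a + i + N) * binomialTransform g (N + 2) i -
      (2 * a + 2 * i + 3 * N) * binomialTransform g (N + 1) i +
      2 * (b + N) * binomialTransform g N i = 0 := by
  induction N with
  | zero =>
    intro i h
    have := h i le_rfl (by omega)
    simp only [binomialTransform, Nat.cast_zero]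
    linear_combination this
  | succ N ih =>
    intro i h
    have h1 := ih i fun j hj hj' => h j hj (by omega)
    have h2 := ih (i + 1) fun j hj hj' => h j (by omega) (by omega)
    have e3 : binomialTransform g (N + 1 + 2) i = binomialTransform g (N + 2) i +
      binomialTransform g (N + 2) (i + 1) := rfl
    have e2 : binomialTransform g (N + 1 + 1) i = binomialTransform g (N + 1) i +
      binomialTransform g (N + 1) (i + 1) := rfl
    have e2' : binomialTransform g (N + 2) i = binomialTransform g (N + 1) i +
      binomialTransform g (N + 1) (i + 1) := rfl
    have e1 : binomialTransform g (N + 1) i = binomialTransform g N i +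
      binomialTransform g N (i + 1) := rfl
    push_cast at h2 ⊢
    rw [e3, e2]
    linear_combination h1 + h2 + (2 * (b + N)) * e1 - (a + i + N) * e2'

theorem choose_succ_mul_cast (N k : ℕ) :
    (N.choose (k + 1) : ℂ) * (k + 1) = N.choose k * (N - k) := by
  rcases le_or_gt k N with h | h
  · have := Nat.choose_succ_right_eq N k
    rw [← Nat.cast_sub h]
    exact_mod_cast this
  · simp [Nat.choose_eq_zero_of_lt h, Nat.choose_eq_zero_of_lt (h.trans k.lt_succ_self)]

/-- The left side is N(N - 1)⋯(N - 2k + 1)/4^k, and (1/2)_k k! = (2k)!/4^k. -/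
theorem risingFact_half_eq_choose (N k : ℕ) :
    risingFact (-((N : ℂ) - 1) / 2) k * risingFact (-(N : ℂ) / 2) k =
      (N.choose (2 * k) : ℂ) * (risingFact (1 / 2) k * (k.factorial : ℂ)) := by
  induction k with
  | zero => simp [risingFact_zero]
  | succ k ih =>
    have h1 := choose_succ_mul_cast N (2 * k)
    have h2 := choose_succ_mul_cast N (2 * k + 1)
    simp only [risingFact_succ, Nat.factorial_succ, Nat.mul_succ]
    push_cast at h1 h2 ⊢
    linear_combination ((-((N : ℂ) - 1) / 2 + k) * (-(N : ℂ) / 2 + k)) * ih -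
      (risingFact (1 / 2) k * k.factorial / 4 * (N - 2 * k - 1)) * h1 -
      (risingFact (1 / 2) k * k.factorial / 4 * (2 * k + 1)) * h2

/-- The left side is N(N - 1)⋯(N - 2k)/4^k, and (3/2)_k k! = (2k + 1)!/4^k. The factor `N` is the
prefactor n + 1 of Q, so N = 0 needs no separate treatment. -/
theorem risingFact_three_half_eq_choose (N k : ℕ) :
    (N : ℂ) * (risingFact (-((N : ℂ) - 2) / 2) k * risingFact (-((N : ℂ) - 1) / 2) k) =
      (N.choose (2 * k + 1) : ℂ) * (risingFact (3 / 2) k * (k.factorial : ℂ)) := by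
  induction k with
  | zero => simp [risingFact_zero]
  | succ k ih =>
    have h1 := choose_succ_mul_cast N (2 * k + 1)
    have h2 := choose_succ_mul_cast N (2 * k + 2)
    simp only [risingFact_succ, Nat.factorial_succ, Nat.mul_succ]
    push_cast at h1 h2 ⊢
    linear_combination ((-((N : ℂ) - 2) / 2 + k) * (-((N : ℂ) - 1) / 2 + k)) * ih -
      (risingFact (3 / 2) k * k.factorial / 4 * (N - 2 * k - 2)) * h1 -
      (risingFact (3 / 2) k * k.factorial / 4 * (2 * k + 2)) * h2

theorem coeffP_eq_sum {n : ℤ} {N : ℕ} (hn : n = N - 1) (a b : ℂ) :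
    coeffP n a b = (∑ k ∈ Finset.range (N + 1), (N.choose (2 * k) : ℂ) *
      (risingFact (a / 2 - b) k / risingFact (a / 2) k)) / 2 ^ N := by
  subst hn
  have hpow : (2 : ℂ) ^ ((N : ℤ) - 1 + 1) = 2 ^ N := by simp
  have hterm : ∀ k : ℕ, risingFact (-(((N - 1 : ℤ) : ℂ)) / 2) k *
      risingFact (-(((N - 1 : ℤ) : ℂ) + 1) / 2) k * risingFact (a / 2 - b) k /
      (risingFact (1 / 2) k * risingFact (a / 2) k * (k.factorial : ℂ)) =
      (N.choose (2 * k) : ℂ) * (risingFact (a / 2 - b) k / risingFact (a / 2) k) := fun k => by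
    have h1 : risingFact (1 / 2) k ≠ 0 := (notPole_of_re_pos (by norm_num)).risingFact_ne_zero k
    have h6 : (k.factorial : ℂ) ≠ 0 := by exact_mod_cast k.factorial_ne_zero
    push_cast
    rw [sub_add_cancel, risingFact_half_eq_choose]
    field_simp
  rw [coeffP, hyp3F2, hpow, one_div_mul_eq_div, tsum_congr hterm,
    tsum_eq_sum (s := Finset.range (N + 1))]
  intro k hk
  rw [Finset.mem_range] at hk
  rw [Nat.choose_eq_zero_of_lt (by omega)]
  simp

theorem coeffQ_eq_sum {n : ℤ} {N : ℕ} (hn : n = N - 1) (a b : ℂ) :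
    coeffQ n a b = (∑ k ∈ Finset.range (N + 1), (N.choose (2 * k + 1) : ℂ) *
      (risingFact ((a + 1) / 2 - b) k / risingFact ((a + 1) / 2) k)) / 2 ^ N := by
  subst hn
  have hpow : (2 : ℂ) ^ ((N : ℤ) - 1 + 1) = 2 ^ N := by simp
  have hterm : ∀ k : ℕ, (N : ℂ) * (risingFact (-(((N - 1 : ℤ) : ℂ) - 1) / 2) k *
      risingFact (-(((N - 1 : ℤ) : ℂ)) / 2) k * risingFact ((a + 1) / 2 - b) k /
      (risingFact (3 / 2) k * risingFact ((a + 1) / 2) k * (k.factorial : ℂ))) =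
      (N.choose (2 * k + 1) : ℂ) *
        (risingFact ((a + 1) / 2 - b) k / risingFact ((a + 1) / 2) k) := fun k => by
    have h1 : risingFact (3 / 2) k ≠ 0 := (notPole_of_re_pos (by norm_num)).risingFact_ne_zero k
    have h6 : (k.factorial : ℂ) ≠ 0 := by exact_mod_cast k.factorial_ne_zero
    have h := risingFact_three_half_eq_choose N k
    push_cast
    rw [show (N : ℂ) - 1 - 1 = N - 2 by ring, mul_div_assoc', ← mul_assoc, h]
    field_simp
  rw [coeffQ, hyp3F2, hpow, div_mul_eq_mul_div, ← tsum_mul_left]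
  have hN : (((N : ℤ) - 1 : ℤ) : ℂ) + 1 = N := by push_cast; ring
  rw [hN, tsum_congr hterm, tsum_eq_sum (s := Finset.range (N + 1))]
  intro k hk
  rw [Finset.mem_range] at hk
  rw [Nat.choose_eq_zero_of_lt (by omega)]
  simp

/-- The sequence with initial values `U`, `V` that satisfies
`(a + j) g (j + 2) = (a + j - 2 b) g j`. -/
noncomputable def interlacedRatio (a b U V : ℂ) (j : ℕ) : ℂ :=
  if Even j then U * (risingFact (a / 2 - b) (j / 2) / risingFact (a / 2) (j / 2))
  else V * (risingFact ((a + 1) / 2 - b) (j / 2) / risingFact ((a + 1) / 2) (j / 2))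

theorem interlacedRatio_even (a b U V : ℂ) (k : ℕ) : interlacedRatio a b U V (2 * k) =
    U * (risingFact (a / 2 - b) k / risingFact (a / 2) k) := by
  simp [interlacedRatio]

theorem interlacedRatio_odd (a b U V : ℂ) (k : ℕ) : interlacedRatio a b U V (2 * k + 1) =
    V * (risingFact ((a + 1) / 2 - b) k / risingFact ((a + 1) / 2) k) := by
  have : (2 * k + 1) / 2 = k := by omega
  simp [interlacedRatio, this]

theorem mul_risingFact_ratio_succ {x y : ℂ} {k : ℕ} (h : x + k ≠ 0) :
    (x + k) * (risingFact y (k + 1) / risingFact x (k + 1)) =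
      (y + k) * (risingFact y k / risingFact x k) := by
  rw [risingFact_succ, risingFact_succ]
  field_simp

theorem interlacedRatio_add_two (a b U V : ℂ) {j : ℕ} (h : a + j ≠ 0) :
    (a + j) * interlacedRatio a b U V (j + 2) =
      (a + j - 2 * b) * interlacedRatio a b U V j := by
  obtain ⟨k, rfl | rfl⟩ := j.even_or_odd'
  · have h1 : a / 2 + k ≠ 0 := fun h0 => h (by push_cast; linear_combination 2 * h0)
    rw [show 2 * k + 2 = 2 * (k + 1) by ring, interlacedRatio_even, interlacedRatio_even]
    have := mul_risingFact_ratio_succ (y := a / 2 - b) h1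
    push_cast
    linear_combination 2 * U * this
  · have h1 : (a + 1) / 2 + k ≠ 0 := fun h0 => h (by push_cast; linear_combination 2 * h0)
    rw [show 2 * k + 1 + 2 = 2 * (k + 1) + 1 by ring, interlacedRatio_odd, interlacedRatio_odd]
    have := mul_risingFact_ratio_succ (y := (a + 1) / 2 - b) h1
    push_cast
    linear_combination 2 * V * this

theorem sum_range_two_mul (h : ℕ → ℂ) (M : ℕ) : ∑ j ∈ Finset.range (2 * M), h j =
    ∑ k ∈ Finset.range M, h (2 * k) + ∑ k ∈ Finset.range M, h (2 * k + 1) := by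
  induction M with
  | zero => simp
  | succ M ih =>
    rw [Nat.mul_succ, Finset.sum_range_succ, Finset.sum_range_succ, ih, Finset.sum_range_succ,
      Finset.sum_range_succ]
    ring

theorem coeffP_mul_add_coeffQ_mul {n : ℤ} {N : ℕ} (hn : n = N - 1) (a b U V : ℂ) :
    coeffP n a b * U + coeffQ n a b * V =
      binomialTransform (interlacedRatio a b U V) N 0 / 2 ^ N := by
  rw [coeffP_eq_sum hn, coeffQ_eq_sum hn,
    -- The range is longer than needed, the extra binomials being zero, so that it splits evenly by
    -- parity.
    binomialTransform_eq_sum _ N 0 (2 * (N + 1)) (by omega), sum_range_two_mul]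
  simp only [zero_add, interlacedRatio_even, interlacedRatio_odd]
  rw [div_mul_eq_mul_div, div_mul_eq_mul_div, ← add_div, Finset.sum_mul, Finset.sum_mul]
  congr 2 <;> exact Finset.sum_congr rfl fun k _ => by ring

/-- Two-step induction with Kummer's theorem at the start. The truncated `N - 1` makes the
hypothesis on `a` empty for N = 0 and N = 1. -/
theorem hyp_neg_one_eq_binomialTransform {a b : ℂ} (hC : NotPole (a - b)) (N : ℕ) :
    risingFact a (N - 1) ≠ 0 → ∀ F, IsHyp (a - 1 + N) b (a - b) F → F (-1) =
      binomialTransform (interlacedRatio a b (kummerValue (a - 1) b) (2 * kummerValue a (b + 1)))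
        N 0 / 2 ^ N := by
  have base : ∀ F, IsHyp (a - 1) b (a - b) F → F (-1) = kummerValue (a - 1) b := fun F hF => by
    have e : 1 + (a - 1) - b = a - b := by ring
    exact kummer (e ▸ hC) (e ▸ hF)
  have h0 := interlacedRatio_even a b (kummerValue (a - 1) b) (2 * kummerValue a (b + 1)) 0
  have h1 := interlacedRatio_odd a b (kummerValue (a - 1) b) (2 * kummerValue a (b + 1)) 0
  simp only [mul_zero, zero_add, risingFact_zero, div_one, mul_one] at h0 h1
  induction N using Nat.twoStepInduction with
  | zero =>
    intro _ F hF
    simpa [binomialTransform, h0] using base F (by simpa using hF)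
  | one =>
    intro _ F hF
    have hF' : IsHyp a b (a - b) F := by simpa using hF
    obtain ⟨G, hG⟩ := exists_isHyp (a - 1) b hC
    obtain ⟨H, hH⟩ := exists_isHyp a (b + 1) hC
    have e : 1 + a - (b + 1) = a - b := by ring
    have hH1 : H (-1) = kummerValue a (b + 1) := kummer (e ▸ hC) (e ▸ hH)
    have := hF'.two_mul_eq hG hH hC neg_one_mem_cutPlane
    rw [base G hG, hH1] at this
    simp only [binomialTransform, h0, zero_add, h1, pow_one]
    linear_combination this / 2
  | more N ih0 ih1 =>
    intro ha F hF
    have hne : ∀ j ≤ N, a + j ≠ 0 := fun j hj h => ha <|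
      (risingFact_eq_zero_iff a _).2 ⟨j, by omega, eq_neg_of_add_eq_zero_left h⟩
    have ha' : ∀ k ≤ N, risingFact a k ≠ 0 := fun k hk h => by
      obtain ⟨j, hj, h⟩ := (risingFact_eq_zero_iff a k).1 h
      exact hne j (by omega) (by rw [h]; ring)
    obtain ⟨G, hG⟩ := exists_isHyp (a - 1 + N) b hC
    obtain ⟨H, hH⟩ := exists_isHyp (a - 1 + (N + 1 : ℕ)) b hC
    have hG1 := ih0 (ha' _ (by omega)) G hG
    have hH1 := ih1 (ha' _ (by omega)) H hH
    have e0 : a - 1 + (N : ℂ) = a + N - 1 := by ring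
    have e1 : a - 1 + ((N + 1 : ℕ) : ℂ) = a + N := by push_cast; ring
    have e2 : a - 1 + ((N + 2 : ℕ) : ℂ) = a + N + 1 := by push_cast; ring
    have key := (e0 ▸ hG).contiguous_left (e1 ▸ hH) (e2 ▸ hF) hC neg_one_mem_cutPlane
    have hrec := binomialTransform_recurrence (b := b) N 0 fun j _ hj =>
      interlacedRatio_add_two a b (kummerValue (a - 1) b) (2 * kummerValue a (b + 1))
        (hne j (by omega))
    rw [hG1, hH1] at key
    have h2 : (2 : ℂ) ^ N ≠ 0 := pow_ne_zero _ two_ne_zero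
    -- The leading coefficient a + N of the recurrence is nonzero because (a)_(N+1) is.
    refine mul_left_cancel₀ (hne N le_rfl) ?_
    simp only [pow_succ, Nat.cast_zero] at key hrec ⊢
    field_simp at key ⊢
    linear_combination -key - hrec

/-! ### The Γ-terms and their removable singularities -/

/-- Legendre duplication replaces the quotient Γ((a+1)/2)/Γ(a) by a multiple of 1/Γ(a/2), which is
entire; hence the Kummer value fills in the singularity. -/
theorem kummerValue_eq_gammaTermP {a : ℂ} (b : ℂ) (ha : NotPole ((a + 1) / 2)) :
    gammaTermP a b = kummerValue (a - 1) b := by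
  have hdup := Gamma_mul_Gamma_add_half (a / 2)
  rw [show a / 2 + 1 / 2 = (a + 1) / 2 by ring, show 2 * (a / 2) = a by ring] at hdup
  have h1 := Gamma_ne_zero ha
  have h2 : (2 : ℂ) ^ (1 - a) ≠ 0 := by simp [cpow_eq_zero_iff]
  have h3 : (√Real.pi : ℂ) ≠ 0 := by
    exact_mod_cast (Real.sqrt_pos.2 Real.pi_pos).ne'
  have h4 : (Gamma a)⁻¹ * Gamma ((a + 1) / 2) =
      √Real.pi * 2 ^ (1 - a) * (Gamma (a / 2))⁻¹ := by
    have e : Gamma (a / 2) = Gamma a * 2 ^ (1 - a) * √Real.pi * (Gamma ((a + 1) / 2))⁻¹ := by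
      rw [← hdup]; field_simp
    rw [e]
    simp only [mul_inv, inv_inv]
    field_simp
  rw [gammaTermP, kummerValue, show 1 + (a - 1) - b = a - b by ring, neg_sub, sub_add_cancel,
    show (a - 1) / 2 + 1 - b = (a + 1) / 2 - b by ring, div_eq_mul_inv, mul_inv]
  linear_combination (Gamma (a - b) * (Gamma ((a + 1) / 2 - b))⁻¹) * h4

theorem kummerValue_eq_gammaTermQ {a : ℂ} (b : ℂ) (ha : NotPole (a / 2)) :
    gammaTermQ a b = 2 * kummerValue a (b + 1) := by
  have hdup := Gamma_mul_Gamma_add_half (a / 2)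
  rw [show a / 2 + 1 / 2 = (a + 1) / 2 by ring, show 2 * (a / 2) = a by ring] at hdup
  have h1 := Gamma_ne_zero ha
  have h2 : (2 : ℂ) ^ (1 - a) ≠ 0 := by simp [cpow_eq_zero_iff]
  have h3 : (√Real.pi : ℂ) ≠ 0 := by
    exact_mod_cast (Real.sqrt_pos.2 Real.pi_pos).ne'
  have h4 : (Gamma a)⁻¹ * Gamma (a / 2) =
      √Real.pi * 2 ^ (1 - a) * (Gamma ((a + 1) / 2))⁻¹ := by
    have e : Gamma ((a + 1) / 2) = Gamma a * 2 ^ (1 - a) * √Real.pi * (Gamma (a / 2))⁻¹ := by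
      rw [← hdup]; field_simp
    rw [e]
    simp only [mul_inv, inv_inv]
    field_simp
  have h5 : (2 : ℂ) ^ (1 - a) = 2 * 2 ^ (-a) := by
    rw [sub_eq_add_neg, cpow_add _ _ two_ne_zero, cpow_one]
  rw [h5] at h4
  rw [gammaTermQ, kummerValue, show 1 + a - (b + 1) = a - b by ring,
    show a / 2 + 1 - (b + 1) = a / 2 - b by ring, div_eq_mul_inv, mul_inv]
  linear_combination (Gamma (a - b) * (Gamma (a / 2 - b))⁻¹) * h4

theorem continuousAt_kummerValue {f g : ℂ → ℂ} {a : ℂ} (hf : ContinuousAt f a)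
    (hg : ContinuousAt g a) (hC : NotPole (1 + f a - g a)) :
    ContinuousAt (fun s => kummerValue (f s) (g s)) a := by
  have hΓ := differentiable_one_div_Gamma.continuous
  have h1 : ContinuousAt (fun s => Gamma (1 + f s - g s)) a :=
    ContinuousAt.comp' (f := fun s => 1 + f s - g s) (differentiableAt_Gamma _ hC).continuousAt
      ((continuousAt_const.add hf).sub hg)
  have h2 : ContinuousAt (fun s => (2 : ℂ) ^ (-f s)) a :=
    continuousAt_const.cpow hf.neg (by simp)
  have h3 : ContinuousAt (fun s => (Gamma ((f s + 1) / 2))⁻¹) a :=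
    ContinuousAt.comp' (f := fun s => (f s + 1) / 2) hΓ.continuousAt
      ((hf.add continuousAt_const).div_const 2)
  have h4 : ContinuousAt (fun s => (Gamma (f s / 2 + 1 - g s))⁻¹) a :=
    ContinuousAt.comp' (f := fun s => f s / 2 + 1 - g s) hΓ.continuousAt
      (((hf.div_const 2).add continuousAt_const).sub hg)
  exact (((h1.mul continuousAt_const).mul h2).mul h3).mul h4

/-- The poles of the Gamma function are isolated. -/
theorem eventually_notPole (x : ℂ) : ∀ᶠ s in 𝓝[≠] x, NotPole s := by
  -- Poles within distance one of `x` have index below `M`, so only finitely many need be avoided.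
  obtain ⟨M, hM⟩ := exists_nat_gt (‖x‖ + 1)
  have hfin : ((fun m : ℕ => -(m : ℂ)) '' Set.Iio M \ {x}).Finite :=
    ((Set.finite_Iio M).image _).subset Set.sdiff_subset
  have h1 : ∀ᶠ s in 𝓝 x, s ∉ (fun m : ℕ => -(m : ℂ)) '' Set.Iio M \ {x} :=
    hfin.isClosed.isOpen_compl.mem_nhds fun h => h.2 rfl
  filter_upwards [mem_nhdsWithin_of_mem_nhds h1, self_mem_nhdsWithin,
    mem_nhdsWithin_of_mem_nhds (Metric.ball_mem_nhds x one_pos)] with s hs hsx hball m hm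
  refine hs ⟨⟨m, ?_, hm.symm⟩, hsx⟩
  rw [Metric.mem_ball, dist_eq_norm] at hball
  have h2 : ‖s‖ ≤ ‖x‖ + ‖s - x‖ := by simpa using norm_add_le x (s - x)
  rw [hm, norm_neg, norm_natCast, ← hm] at h2
  have : (m : ℝ) < M := by linarith
  exact_mod_cast this

theorem eventually_notPole_comp {f : ℂ → ℂ} (a : ℂ) (hf : Continuous f)
    (hinj : Function.Injective f) : ∀ᶠ s in 𝓝[≠] a, NotPole (f s) :=
  have h : Tendsto f (𝓝[≠] a) (𝓝[≠] f a) :=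
    tendsto_nhdsWithin_iff.2 ⟨hf.continuousAt.tendsto.mono_left nhdsWithin_le_nhds,
      eventually_mem_nhdsWithin.mono fun _ hs => hinj.ne hs⟩
  h.eventually (eventually_notPole (f a))

/-! ### Termination of the series and the theorem -/

theorem terminates3F2_coeffP {n : ℤ} {N : ℕ} (hn : n = N - 1) {a : ℂ} (c : ℂ)
    (ha : risingFact a (N - 1) ≠ 0) :
    Terminates3F2 (-(n : ℂ) / 2) (-((n : ℂ) + 1) / 2) c (1 / 2) (a / 2) := by
  subst hn
  have hden : ∀ m, 2 * m ≤ N → ∀ k ≤ m,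
      risingFact (1 / 2) k ≠ 0 ∧ risingFact (a / 2) k ≠ 0 := fun m hm k hk =>
    ⟨(notPole_of_re_pos (by norm_num)).risingFact_ne_zero k, fun h => by
      obtain ⟨j, hj, h⟩ := (risingFact_eq_zero_iff _ _).1 h
      -- A zero of (a/2)_k forces a = -2j with 2j ≤ 2m - 2 < N - 1, and then (a)_(N-1) would vanish.
      exact ha ((risingFact_eq_zero_iff _ _).2
        ⟨2 * j, by omega, by push_cast; linear_combination 2 * h⟩)⟩
  obtain ⟨m, rfl | rfl⟩ := N.even_or_odd'
  · exact ⟨m, Or.inr (Or.inl (by push_cast; ring)), hden m le_rfl⟩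
  · exact ⟨m, Or.inl (by push_cast; ring), hden m (by omega)⟩

theorem terminates3F2_coeffQ {n : ℤ} {N : ℕ} (hn : n = N) {a : ℂ} (c : ℂ)
    (ha : risingFact a N ≠ 0) :
    Terminates3F2 (-((n : ℂ) - 1) / 2) (-(n : ℂ) / 2) c (3 / 2) ((a + 1) / 2) := by
  subst hn
  have hden : ∀ m, 2 * m ≤ N → ∀ k ≤ m,
      risingFact (3 / 2) k ≠ 0 ∧ risingFact ((a + 1) / 2) k ≠ 0 := fun m hm k hk =>
    ⟨(notPole_of_re_pos (by norm_num)).risingFact_ne_zero k, fun h => by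
      obtain ⟨j, hj, h⟩ := (risingFact_eq_zero_iff _ _).1 h
      exact ha ((risingFact_eq_zero_iff _ _).2
        ⟨2 * j + 1, by omega, by push_cast; linear_combination 2 * h⟩)⟩
  obtain ⟨m, rfl | rfl⟩ := N.even_or_odd'
  · exact ⟨m, Or.inr (Or.inl (by push_cast; ring)), hden m le_rfl⟩
  · exact ⟨m, Or.inl (by push_cast; ring), hden m (by omega)⟩

theorem theorem1 (n : ℤ) (hn : -1 ≤ n) (a b : ℂ)
    (ha : risingFact a n.toNat ≠ 0) (hab : ∀ m : ℕ, a - b ≠ -(m : ℂ)) :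
    Terminates3F2 (-(n : ℂ) / 2) (-((n : ℂ) + 1) / 2) (a / 2 - b) (1 / 2) (a / 2) ∧
    (0 ≤ n → Terminates3F2 (-((n : ℂ) - 1) / 2) (-(n : ℂ) / 2) ((a + 1) / 2 - b)
      (3 / 2) ((a + 1) / 2)) ∧
    ∃ U V : ℂ,
      -- `U`, `V` are the two `Γ`-terms at `(a, b)`, removable singularities being filled in
      Tendsto (fun s => gammaTermP s b) (𝓝[≠] a) (𝓝 U) ∧
      ((∀ m : ℕ, (a + 1) / 2 ≠ -(m : ℂ)) → U = gammaTermP a b) ∧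
      Tendsto (fun s => gammaTermQ s b) (𝓝[≠] a) (𝓝 V) ∧
      ((∀ m : ℕ, a / 2 ≠ -(m : ℂ)) → V = gammaTermQ a b) ∧
      (∃ F : ℂ → ℂ, IsHyp2F1 (a + n) b (a - b) F) ∧
      ∀ F : ℂ → ℂ, IsHyp2F1 (a + n) b (a - b) F →
        F (-1) = coeffP n a b * U + coeffQ n a b * V := by
  have hC : NotPole (a - b) := hab
  obtain ⟨N, hN⟩ : ∃ N : ℕ, n = N - 1 := ⟨(n + 1).toNat, by omega⟩
  have ha' : risingFact a (N - 1) ≠ 0 := by rwa [show N - 1 = n.toNat by omega]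
  -- The witnesses for `U` and `V` are Kummer values: they are continuous in `a` and agree with the
  -- Γ-terms on a punctured neighbourhood, hence are their limits.
  refine ⟨terminates3F2_coeffP hN _ ha', fun h0 => terminates3F2_coeffQ (N := N - 1)
    (by omega) _ ha', kummerValue (a - 1) b, 2 * kummerValue a (b + 1), ?_,
    fun h => (kummerValue_eq_gammaTermP b h).symm, ?_,
    fun h => (kummerValue_eq_gammaTermQ b h).symm, ?_, fun F hF => ?_⟩
  · have hcont : ContinuousAt (fun s => kummerValue (s - 1) b) a :=
      continuousAt_kummerValue (by fun_prop) (by fun_prop)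
        (by rwa [show 1 + (a - 1) - b = a - b by ring])
    refine (hcont.tendsto.mono_left nhdsWithin_le_nhds).congr' ?_
    filter_upwards [eventually_notPole_comp (f := fun s => (s + 1) / 2) a (by fun_prop)
      fun s t h => by simpa using h] with s hs
    exact (kummerValue_eq_gammaTermP b hs).symm
  · have hcont : ContinuousAt (fun s => 2 * kummerValue s (b + 1)) a :=
      continuousAt_const.mul (continuousAt_kummerValue (by fun_prop) (by fun_prop)
        (by rwa [show 1 + a - (b + 1) = a - b by ring]))
    refine (hcont.tendsto.mono_left nhdsWithin_le_nhds).congr' ?_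
    filter_upwards [eventually_notPole_comp (f := fun s => s / 2) a (by fun_prop)
      fun s t h => by simpa using h] with s hs
    exact (kummerValue_eq_gammaTermQ b hs).symm
  · obtain ⟨F, hF⟩ := exists_isHyp (a + n) b hC
    exact ⟨F, (isHyp2F1_iff hC F).2 hF⟩
  · rw [coeffP_mul_add_coeffQ_mul hN]
    refine hyp_neg_one_eq_binomialTransform hC N ha' F ?_
    have e : a - 1 + (N : ℂ) = a + n := by rw [hN]; push_cast; ring
    rw [e]
    exact (isHyp2F1_iff hC F).1 hF
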